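/- Let $n\ge 3$ and $d\ge 3$, let $\Bbbk$ be a field of characteristic zero and $S=\Bbbk[x_1,\dots,x_n]$. For a homogeneous ideal $I\subset S$ put $R=S/I$, let $R_j$ be the degree-$j$ part of $R$, and let $\mathrm{HF}(R,j)=\dim_\Bbbk R_j$. For a linear form $\ell$, the map $\ell^i:R_j\to R_{j+i}$ is multiplication by $\ell^i$; it has maximal rank if it is injective or surjective. $R$ has the strong Lefschetz property (SLP) if there is a linear form $\ell$ such that $\ell^i:R_j\to R_{j+i}$ has maximal rank for all $i\ge 1$ and all $j\ge 0$. A property holds for a general linear form if it holds for all $a_1x_1+\cdots+a_nx_n$ with $F(a_1,\dots,a_n)\neq 0$, for some nonzero polynomial $F$ over $\Bbbk$. Consider the following three classes of ideals $I\subset S$ with $S/I$ artinian: (a) ideals generated by forms of degree $d$; (b) monomial ideals $(m_1,\dots,m_s)$ with $\min_i\deg m_i=d$; (c) ideals $(f_1,\dots,f_s)$ generated by nonzero forms with $\min_i\deg f_i=d$. (i) If $I$ belongs to one of these classes and $R=S/I$ fails the SLP, then $\mathrm{HF}(R,d)\ge 3$. This is sharp in each class: there is an ideal $I$, belonging to all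 three classes, such that $R=S/I$ fails the SLP, $\mathrm{HF}(R,d)=3$, and $\ell^{d-1}:R_1\to R_d$ is not surjective for any linear form $\ell$. (ii) Let $1\le i\le d-1$ and let $I$ belong to one of these classes. If it is not the case that, for a general linear form $\ell$, the map $\ell^i:R_j\to R_{j+i}$ has maximal rank for every $j\ge 0$, then $$\mathrm{HF}(R,d)\ge d-i+2.$$ For $I$ in class (b) the same bound holds if, for $\ell=x_1+\cdots+x_n$, the map $\ell^i:R_j\to R_{j+i}$ fails to have maximal rank for some $j\ge 0$. The bound is sharp in each class for every $2\le i\le d-1$: there is an ideal $I$, belonging to all three classes, such that $\mathrm{HF}(R,d)=d-i+2$ and, for every linear form $\ell$, the map $\ell^i:R_{d-i}\to R_d$ is not surjective and does not have maximal rank. -/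

import Mathlib

noncomputable section

namespace Lefschetz

variable {k : Type*} [Field k] {n : ℕ}

/-- The graded piece `R_j` of `R = k[x_1, …, x_n] / I`: the image in `R` of the forms of
degree `j` (including zero). -/
def gradedPiece (I : Ideal (MvPolynomial (Fin n) k)) (j : ℕ) :
    Submodule k (MvPolynomial (Fin n) k ⧸ I) :=
  (MvPolynomial.homogeneousSubmodule (Fin n) k j).map (Ideal.Quotient.mkₐ k I).toLinearMap

/-- The value in degree `j` of the Hilbert function of `R = k[x_1, …, x_n] / I`. -/
def HF (I : Ideal (MvPolynomial (Fin n) k)) (j : ℕ) : ℕ :=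
  Module.finrank k (gradedPiece I j)

/-- Multiplication by (the class of) `ℓ ^ i` on `R = k[x_1, …, x_n] / I`. -/
def mulPow (I : Ideal (MvPolynomial (Fin n) k)) (ℓ : MvPolynomial (Fin n) k) (i : ℕ) :
    (MvPolynomial (Fin n) k ⧸ I) →ₗ[k] (MvPolynomial (Fin n) k ⧸ I) :=
  LinearMap.mulLeft k (Ideal.Quotient.mk I ℓ ^ i)

/-- For a linear form `ℓ`, multiplication by `ℓ ^ i` maps `R_j` to `R_{j+i}`. -/
theorem mulPow_mapsTo (I : Ideal (MvPolynomial (Fin n) k)) {ℓ : MvPolynomial (Fin n) k}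
    (hℓ : ℓ.IsHomogeneous 1) (i j : ℕ) :
    Set.MapsTo (mulPow I ℓ i) (gradedPiece I j) (gradedPiece I (j + i)) := by
  rintro _ ⟨f, hf, rfl⟩
  refine ⟨ℓ ^ i * f, ?_, ?_⟩
  · have h := (hℓ.pow i).mul ((MvPolynomial.mem_homogeneousSubmodule j f).1 hf)
    rw [one_mul, add_comm] at h
    exact (MvPolynomial.mem_homogeneousSubmodule _ _).2 h
  · simp [mulPow]

/-- The map `ℓ ^ i : R_j → R_{j+i}` is injective. -/
def InjectiveInDegree (I : Ideal (MvPolynomial (Fin n) k)) (ℓ : MvPolynomial (Fin n) k)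
    (i j : ℕ) : Prop :=
  Set.InjOn (mulPow I ℓ i) (gradedPiece I j)

/-- The map `ℓ ^ i : R_j → R_{j+i}` is surjective. -/
def SurjectiveInDegree (I : Ideal (MvPolynomial (Fin n) k)) (ℓ : MvPolynomial (Fin n) k)
    (i j : ℕ) : Prop :=
  Set.SurjOn (mulPow I ℓ i) (gradedPiece I j) (gradedPiece I (j + i))

/-- The map `ℓ ^ i : R_j → R_{j+i}` has maximal rank. -/
def MaximalRankInDegree (I : Ideal (MvPolynomial (Fin n) k)) (ℓ : MvPolynomial (Fin n) k)
    (i j : ℕ) : Prop :=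
  InjectiveInDegree I ℓ i j ∨ SurjectiveInDegree I ℓ i j

/-- The strong Lefschetz property of `R = k[x_1, …, x_n] / I`. -/
def HasSLP (I : Ideal (MvPolynomial (Fin n) k)) : Prop :=
  ∃ ℓ : MvPolynomial (Fin n) k, ℓ.IsHomogeneous 1 ∧
    ∀ i : ℕ, 1 ≤ i → ∀ j : ℕ, MaximalRankInDegree I ℓ i j

/-- `P` holds for a general linear form: it holds for all `a_1 x_1 + ⋯ + a_n x_n` whose
coefficient vector lies in some fixed nonempty principal Zariski-open subset of `k^n`
(`k` being infinite). -/
def ForGeneralLinearForm (P : MvPolynomial (Fin n) k → Prop) : Prop :=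
  ∃ F : MvPolynomial (Fin n) k, F ≠ 0 ∧
    ∀ a : Fin n → k, MvPolynomial.eval a F ≠ 0 →
      P (∑ t, MvPolynomial.C (a t) * MvPolynomial.X t)

/-- `I` is generated by (finitely many) forms of degree `d`. -/
def GeneratedInDegree (I : Ideal (MvPolynomial (Fin n) k)) (d : ℕ) : Prop :=
  ∃ G : Finset (MvPolynomial (Fin n) k),
    (∀ g ∈ G, g.IsHomogeneous d) ∧ I = Ideal.span (G : Set (MvPolynomial (Fin n) k))

/-- `I` is generated by finitely many monomials, the least degree of which is `d`. -/
def MonomialOfMinDegree (I : Ideal (MvPolynomial (Fin n) k)) (d : ℕ) : Prop :=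
  ∃ M : Finset (Fin n →₀ ℕ),
    (∀ m ∈ M, d ≤ m.degree) ∧ (∃ m ∈ M, m.degree = d) ∧
      I = Ideal.span ((fun m => MvPolynomial.monomial m (1 : k)) '' (M : Set (Fin n →₀ ℕ)))

/-- `I` is generated by finitely many nonzero forms, the least degree of which is `d`. -/
def HomogeneousOfMinDegree (I : Ideal (MvPolynomial (Fin n) k)) (d : ℕ) : Prop :=
  ∃ G : Finset (MvPolynomial (Fin n) k),
    (∀ g ∈ G, g ≠ 0 ∧ ∃ e, d ≤ e ∧ g.IsHomogeneous e) ∧ (∃ g ∈ G, g.IsHomogeneous d) ∧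
      I = Ideal.span (G : Set (MvPolynomial (Fin n) k))

end Lefschetz

end

/-! Everything rests on one surjectivity statement: if `HF I d ≤ d + 1 - i`, then `ℓ ^ i` maps
`R_{d-i}` onto `R_d` for general `ℓ` (`exists_surjectiveInDegree`). Since `I` starts in degree `d`,
injectivity is automatic below degree `d` and surjectivity onto `R_d` propagates upwards, so this
gives maximal rank in every degree.

The statement is proved dually. Let `L = ∑ a_t x_t` have indeterminate coefficients; elements of
`MvPolynomial σ (MvPolynomial σ k)` have outer variables `a` and coefficients in `k[x]`. Let `A_p`
be the `k[a]`-module of vectors orthogonal to the image of all multiples of `L ^ p`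
(`powAnnihilator`). The `A_p` increase and are saturated, and `∂/∂a_t` maps `A_p` into `A_{p+1}`. If
`A_p = A_{p+1}` with `p ≤ d`, then `A_p` is stable under differentiation; differentiating `L ^ p`
down to all monomials of degree `p` in `x` (characteristic zero) forces `A_p = 0`. Hence if `A_i ≠
0`, the ranks of `A_i, …, A_{d+1}` grow strictly, and the last is at least `d + 2 - i`, which
exceeds `dim R_d` (`powAnnihilator_eq_bot`).

For sharpness, only the monomials `x^s y^(e-s) z^c` survive in degree `d = e + c`. A specialization
at a zero `(u, v)` of the `x, y` part of `ℓ` gives a functional on `R_d` that kills the image of `ℓ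
^ (c + 1)`. -/

noncomputable section

namespace Lefschetz

open MvPolynomial

/-! ### Pairing vectors over `k[a]` with polynomials in `a` over `k[x]`. -/

section Generic

variable {σ ι k : Type*} [Field k]

/-- Apply a linear functional on `k[x]` to the coefficients of a polynomial over `k[x]`. -/
def coeffMap (φ : MvPolynomial σ k →ₗ[k] k) :
    MvPolynomial σ (MvPolynomial σ k) →ₗ[k] MvPolynomial σ k where
  toFun f := ∑ μ ∈ f.support, monomial μ (φ (coeff μ f))
  map_add' f g := by
    classical
    ext ν
    simp only [coeff_add, coeff_sum, coeff_monomial, Finset.sum_ite_eq', mem_support_iff]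
    by_cases hf : coeff ν f = 0 <;> by_cases hg : coeff ν g = 0 <;> simp [hf, hg]
    intro h
    rw [← map_add, h, map_zero]
  map_smul' c f := by
    classical
    ext ν
    simp only [coeff_smul, coeff_sum, coeff_monomial, Finset.sum_ite_eq', mem_support_iff]
    by_cases hf : coeff ν f = 0 <;> by_cases hc : c = 0 <;> simp [hf, hc]

theorem coeff_coeffMap (φ : MvPolynomial σ k →ₗ[k] k) (f : MvPolynomial σ (MvPolynomial σ k))
    (ν : σ →₀ ℕ) : coeff ν (coeffMap φ f) = φ (coeff ν f) := by
  classical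
  simp only [coeffMap, LinearMap.coe_mk, AddHom.coe_mk, coeff_sum, coeff_monomial,
    Finset.sum_ite_eq', mem_support_iff]
  by_cases hf : coeff ν f = 0 <;> simp [hf]

theorem coeffMap_monomial (φ : MvPolynomial σ k →ₗ[k] k) (ν : σ →₀ ℕ) (s : MvPolynomial σ k) :
    coeffMap φ (monomial ν s) = monomial ν (φ s) := by
  classical
  ext μ
  rw [coeff_coeffMap, coeff_monomial, coeff_monomial]
  split_ifs <;> simp

theorem coeffMap_C (φ : MvPolynomial σ k →ₗ[k] k) (s : MvPolynomial σ k) :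
    coeffMap φ (C s) = C (φ s) := coeffMap_monomial φ 0 s

theorem pderiv_coeffMap (φ : MvPolynomial σ k →ₗ[k] k) (t : σ)
    (f : MvPolynomial σ (MvPolynomial σ k)) :
    pderiv t (coeffMap φ f) = coeffMap φ (pderiv t f) := by
  induction f using MvPolynomial.induction_on' with
  | monomial ν s =>
    rw [coeffMap_monomial, pderiv_monomial, pderiv_monomial, coeffMap_monomial]
    congr 1
    rw [mul_comm s, ← nsmul_eq_mul, map_nsmul, nsmul_eq_mul, mul_comm]
  | add p q hp hq => simp only [map_add, hp, hq]

theorem eval_coeffMap (φ : MvPolynomial σ k →ₗ[k] k) (a : σ → k)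
    (f : MvPolynomial σ (MvPolynomial σ k)) :
    eval a (coeffMap φ f) = φ (eval (fun t => C (a t)) f) := by
  induction f using MvPolynomial.induction_on' with
  | monomial ν s =>
    rw [coeffMap_monomial, eval_monomial, eval_monomial]
    have : (ν.prod fun t e => (C (a t) : MvPolynomial σ k) ^ e) =
        C (ν.prod fun t e => a t ^ e) := by
      simp [Finsupp.prod, map_prod]
    rw [this, mul_comm s, ← smul_eq_C_mul, map_smul, smul_eq_mul, mul_comm]
  | add p q hp hq => simp only [map_add, hp, hq]

variable [Fintype ι]

/-- The pairing of a vector of polynomials in the coefficients `a` with polynomials over `k[x]`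
induced by a `k`-linear map `k[x] → k^ι`. -/
def pairing (φ : MvPolynomial σ k →ₗ[k] (ι → k)) (G : ι → MvPolynomial σ k)
    (f : MvPolynomial σ (MvPolynomial σ k)) : MvPolynomial σ k :=
  ∑ r, G r * coeffMap (LinearMap.proj r ∘ₗ φ) f

theorem pairing_add_right (φ : MvPolynomial σ k →ₗ[k] (ι → k)) (G : ι → MvPolynomial σ k)
    (f g : MvPolynomial σ (MvPolynomial σ k)) :
    pairing φ G (f + g) = pairing φ G f + pairing φ G g := by
  simp [pairing, mul_add, Finset.sum_add_distrib]

theorem pairing_nsmul_right (φ : MvPolynomial σ k →ₗ[k] (ι → k)) (G : ι → MvPolynomial σ k)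
    (m : ℕ) (f : MvPolynomial σ (MvPolynomial σ k)) :
    pairing φ G (m • f) = m • pairing φ G f := by
  simp only [pairing, map_nsmul, mul_smul_comm, Finset.smul_sum]

theorem pderiv_pairing (φ : MvPolynomial σ k →ₗ[k] (ι → k)) (G : ι → MvPolynomial σ k) (t : σ)
    (f : MvPolynomial σ (MvPolynomial σ k)) :
    pderiv t (pairing φ G f) =
      pairing φ (fun r => pderiv t (G r)) f + pairing φ G (pderiv t f) := by
  simp only [pairing, map_sum, Derivation.leibniz, pderiv_coeffMap, smul_eq_mul,
    Finset.sum_add_distrib]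
  rw [add_comm]
  congr 1
  exact Finset.sum_congr rfl fun r _ => mul_comm _ _

/-! ### The generic linear form and the annihilators of its powers. -/

variable [Fintype σ]

variable (σ k) in
/-- The linear form `∑ a_t x_t` with indeterminate coefficients. -/
def genericForm : MvPolynomial σ (MvPolynomial σ k) := ∑ t, C (X t) * X t

theorem pderiv_genericForm (t : σ) : pderiv t (genericForm σ k) = C (X t) := by
  classical
  simp [genericForm, pderiv_X, Pi.single_apply]

theorem eval_genericForm (a : σ → k) :
    eval (fun t => C (a t)) (genericForm σ k) = ∑ t, C (a t) * X t := by
  simp [genericForm, mul_comm]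

theorem pderiv_genericForm_pow_mul (t : σ) (p : ℕ) (f : MvPolynomial σ (MvPolynomial σ k)) :
    pderiv t (genericForm σ k ^ (p + 1) * f) =
      (p + 1 : ℕ) • (genericForm σ k ^ p * (C (X t) * f)) +
        genericForm σ k ^ (p + 1) * pderiv t f := by
  rw [Derivation.leibniz, Derivation.leibniz_pow, pderiv_genericForm]
  simp only [smul_eq_mul, Nat.add_sub_cancel, nsmul_eq_mul]
  ring

/-- The vectors orthogonal to all multiples of the `p`-th power of the generic linear form. -/
def powAnnihilator (φ : MvPolynomial σ k →ₗ[k] (ι → k)) (p : ℕ) :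
    Submodule (MvPolynomial σ k) (ι → MvPolynomial σ k) where
  carrier := {G | ∀ f, pairing φ G (genericForm σ k ^ p * f) = 0}
  add_mem' {G H} hG hH f := by
    have : pairing φ (G + H) (genericForm σ k ^ p * f) =
        pairing φ G (genericForm σ k ^ p * f) + pairing φ H (genericForm σ k ^ p * f) := by
      simp [pairing, add_mul, Finset.sum_add_distrib]
    rw [this, hG f, hH f, add_zero]
  zero_mem' f := by simp [pairing]
  smul_mem' c G hG f := by
    have : pairing φ (c • G) (genericForm σ k ^ p * f) =
        c * pairing φ G (genericForm σ k ^ p * f) := by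
      simp [pairing, mul_assoc, Finset.mul_sum]
    rw [this, hG f, mul_zero]

variable {φ : MvPolynomial σ k →ₗ[k] (ι → k)}

theorem powAnnihilator_le_succ (p : ℕ) : powAnnihilator φ p ≤ powAnnihilator φ (p + 1) := by
  intro G hG f
  rw [pow_succ, mul_assoc]
  exact hG _

theorem powAnnihilator_mono {p q : ℕ} (h : p ≤ q) : powAnnihilator φ p ≤ powAnnihilator φ q :=
  monotone_nat_of_le_succ powAnnihilator_le_succ h

/-- Saturation, from `k[a]` being a domain. It is what makes a strict inclusion of annihilators
raise the rank. -/
theorem mem_powAnnihilator_of_smul_mem {p : ℕ} {c : MvPolynomial σ k} (hc : c ≠ 0)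
    {G : ι → MvPolynomial σ k} (h : c • G ∈ powAnnihilator φ p) : G ∈ powAnnihilator φ p := by
  intro f
  have h1 := h f
  have : pairing φ (c • G) (genericForm σ k ^ p * f) =
      c * pairing φ G (genericForm σ k ^ p * f) := by
    simp [pairing, mul_assoc, Finset.mul_sum]
  rw [this] at h1
  exact (mul_eq_zero.1 h1).resolve_left hc

/-- Differentiating `L ^ (p + 1) * f` leaves a factor `L ^ p` in each term, which `G` annihilates;
by the product rule only the term with `∂G` remains. -/
theorem pderiv_mem_powAnnihilator_succ {p : ℕ} {G : ι → MvPolynomial σ k}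
    (hG : G ∈ powAnnihilator φ p) (t : σ) :
    (fun r => pderiv t (G r)) ∈ powAnnihilator φ (p + 1) := by
  intro f
  have h := pderiv_pairing φ G t (genericForm σ k ^ (p + 1) * f)
  rw [powAnnihilator_le_succ p hG f, map_zero, pderiv_genericForm_pow_mul, pairing_add_right,
    pairing_nsmul_right, hG, powAnnihilator_le_succ p hG, smul_zero, add_zero, add_zero] at h
  exact h.symm

variable [CharZero k]

/-- A differentially stable annihilator of the `p`-th power of the generic linear form also
annihilates all monomials of degree `p`. -/
theorem pairing_monomial_eq_zero_of_stable {p : ℕ}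
    (hp : powAnnihilator φ (p + 1) ≤ powAnnihilator φ p) (q r : ℕ) (hqr : r + q = p)
    (ν : σ →₀ ℕ) (hν : ν.degree = q) {G : ι → MvPolynomial σ k} (hG : G ∈ powAnnihilator φ p)
    (f : MvPolynomial σ (MvPolynomial σ k)) :
    pairing φ G (genericForm σ k ^ r * (C (monomial ν 1) * f)) = 0 := by
  induction q generalizing r ν G f with
  | zero =>
    obtain rfl : r = p := by omega
    exact hG _
  | succ q ih =>
    obtain ⟨t, ht⟩ : ∃ t, ν t ≠ 0 := by
      by_contra! h
      have : ν = 0 := by ext t; simpa using h t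
      simp [this] at hν
    obtain ⟨ν', rfl⟩ : ∃ ν', ν = Finsupp.single t 1 + ν' := by
      refine exists_add_of_le (Finsupp.single_le_iff.2 (by omega))
    have hν' : ν'.degree = q := by
      rw [map_add, Finsupp.degree_single] at hν
      omega
    -- One factor `L` is traded for `x_t` by differentiating in `a_t`. By induction all terms vanish
    -- except `(r + 1)` times the wanted pairing, and `r + 1` is invertible.
    have h := pderiv_pairing φ G t (genericForm σ k ^ (r + 1) * (C (monomial ν' 1) * f))
    rw [ih (r + 1) (by omega) ν' hν' hG, map_zero,
      ih (r + 1) (by omega) ν' hν' (hp (pderiv_mem_powAnnihilator_succ hG t)),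
      pderiv_genericForm_pow_mul, pairing_add_right, pairing_nsmul_right, zero_add,
      Derivation.leibniz, pderiv_C, smul_zero, add_zero, smul_eq_mul,
      ih (r + 1) (by omega) ν' hν' hG, add_zero] at h
    have h2 := (smul_eq_zero.1 h.symm).resolve_left (Nat.succ_ne_zero r)
    have h3 : (monomial (Finsupp.single t 1 + ν') 1 : MvPolynomial σ k) = X t * monomial ν' 1 := by
      rw [X, monomial_mul, one_mul]
    rw [h3, C_mul, mul_assoc]
    exact h2

/-- A differentially stable annihilator of the `p`-th power of the generic linear form also
annihilates all polynomials without terms of degree less than `p`. -/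
theorem pairing_C_mul_eq_zero_of_stable {p : ℕ}
    (hp : powAnnihilator φ (p + 1) ≤ powAnnihilator φ p) {G : ι → MvPolynomial σ k}
    (hG : G ∈ powAnnihilator φ p) {s : MvPolynomial σ k} (hs : s ∈ idealOfVars σ k ^ p)
    (f : MvPolynomial σ (MvPolynomial σ k)) : pairing φ G (C s * f) = 0 := by
  rw [pow_idealOfVars_eq_span] at hs
  induction hs using Submodule.span_induction generalizing f with
  | mem x hx =>
    obtain ⟨ν, hν, rfl⟩ := hx
    have := pairing_monomial_eq_zero_of_stable hp p 0 (zero_add p) ν hν hG f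
    rwa [pow_zero, one_mul] at this
  | zero => simp [pairing]
  | add x y _ _ hx hy => rw [C_add, add_mul, pairing_add_right, hx, hy, add_zero]
  | smul a x _ hx => rw [smul_eq_mul, mul_comm a, C_mul, mul_assoc, hx]

/-- A form of degree `d ≥ p` lies in the `p`-th power of the ideal of variables, so `G` is
orthogonal to its image; choosing forms that map to the unit vectors makes each entry of `G` vanish.
-/
theorem powAnnihilator_eq_bot_of_stable {d p : ℕ} (hpd : p ≤ d)
    (hφ : ∀ y, ∃ f : MvPolynomial σ k, f.IsHomogeneous d ∧ φ f = y)
    (hp : powAnnihilator φ (p + 1) ≤ powAnnihilator φ p) : powAnnihilator φ p = ⊥ := by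
  classical
  rw [eq_bot_iff]
  intro G hG
  rw [Submodule.mem_bot]
  ext1 r
  obtain ⟨f, hf, hfr⟩ := hφ (Pi.single r 1)
  have hf' : f ∈ idealOfVars σ k ^ p :=
    (mem_pow_idealOfVars_iff p f).2 fun x hx => by
      rwa [Finsupp.degree_apply, ← hf.degree_eq_sum_deg_support hx]
  have := pairing_C_mul_eq_zero_of_stable hp hG hf' 1
  simpa [pairing, coeffMap_C, hfr, Pi.single_apply] using this

/-- If some nonzero vector annihilates the `i`-th power of the generic linear form, then so many
powers have distinct annihilators that the vectors have at least `d + 2 - i` entries. -/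
theorem powAnnihilator_eq_bot {d i : ℕ} (hid : i ≤ d)
    (hφ : ∀ y, ∃ f : MvPolynomial σ k, f.IsHomogeneous d ∧ φ f = y)
    (hι : Fintype.card ι + i ≤ d + 1) : powAnnihilator φ i = ⊥ := by
  by_contra hne
  -- The annihilator of `L ^ (i + s)` has rank at least `s + 1`: each step is strict and adds one
  -- independent vector.
  have key : ∀ s, i + s ≤ d + 1 → ∃ v : Fin (s + 1) → ι → MvPolynomial σ k,
      LinearIndependent (MvPolynomial σ k) v ∧ ∀ j, v j ∈ powAnnihilator φ (i + s) := by
    intro s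
    induction s with
    | zero =>
      intro _
      obtain ⟨G, hG, hG0⟩ := Submodule.exists_mem_ne_zero_of_ne_bot hne
      exact ⟨fun _ => G, LinearIndependent.of_subsingleton (ι := Fin 1) 0 hG0, fun _ => hG⟩
    | succ s ih =>
      intro hs
      obtain ⟨v, hv, hvmem⟩ := ih (by omega)
      obtain ⟨x, hx, hx'⟩ := SetLike.not_le_iff_exists.1 fun h =>
        hne (le_bot_iff.1 ((powAnnihilator_mono (Nat.le_add_right i s)).trans
          (powAnnihilator_eq_bot_of_stable (by omega : i + s ≤ d) hφ h).le))
      refine ⟨Fin.cons x v, hv.finCons' x v ?_, ?_⟩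
      · intro c y hy hxy
        by_contra hc
        -- A dependence with nonzero coefficient `c` at `x` would put `c • x`, hence by saturation
        -- `x`, in the smaller annihilator.
        refine hx' (mem_powAnnihilator_of_smul_mem hc ?_)
        rw [eq_neg_of_add_eq_zero_left hxy]
        refine neg_mem ((Submodule.span_le.2 ?_) hy)
        rintro _ ⟨j, rfl⟩
        exact hvmem j
      · intro j
        refine Fin.cases hx (fun j => ?_) j
        exact powAnnihilator_le_succ _ (hvmem j)
  obtain ⟨v, hv, -⟩ := key (d + 1 - i) (by omega)
  have := hv.fintype_card_le_finrank
  rw [Module.finrank_fintype_fun_eq_card, Fintype.card_fin] at this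
  omega

/-! ### From the generic linear form to a general one. -/

/-- For a surjection from the forms of degree `d` onto a space of dimension at most `d + 1 - i`,
the multiples of the `i`-th power of a general linear form already surject. -/
theorem exists_forall_eval_ne_zero_surjective {d i : ℕ} (hid : i ≤ d)
    (hφ : ∀ y, ∃ f : MvPolynomial σ k, f.IsHomogeneous d ∧ φ f = y)
    (hι : Fintype.card ι + i ≤ d + 1) :
    ∃ F : MvPolynomial σ k, F ≠ 0 ∧ ∀ a : σ → k, eval a F ≠ 0 →
      ∀ y, ∃ g, φ ((∑ t, C (a t) * X t) ^ i * g) = y := by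
  classical
  let K := FractionRing (MvPolynomial σ k)
  let w : MvPolynomial σ (MvPolynomial σ k) → ι → MvPolynomial σ k := fun f r =>
    coeffMap (LinearMap.proj r ∘ₗ φ) (genericForm σ k ^ i * f)
  let wK : MvPolynomial σ (MvPolynomial σ k) → ι → K := fun f r => algebraMap _ K (w f r)
  -- Otherwise a nonzero functional over the fraction field kills all multiples of `L ^ i`; clearing
  -- denominators turns it into a nonzero element of the annihilator.
  have hspan : ⊤ ≤ Submodule.span K (Set.range wK) := by
    by_contra hlt
    obtain ⟨θ, hθ0, hθ⟩ := Submodule.exists_le_ker_of_lt_top _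
      (lt_top_iff_ne_top.2 fun h => hlt h.ge)
    obtain ⟨b, hb⟩ := IsLocalization.exist_integer_multiples_of_finite
      (nonZeroDivisors (MvPolynomial σ k)) (fun r : ι => θ (Pi.single r 1))
    choose G hG using hb
    have hGmem : G ∈ powAnnihilator φ i := by
      intro f
      apply IsFractionRing.injective (MvPolynomial σ k) K
      have h0 : θ (wK f) = 0 := hθ (Submodule.subset_span ⟨f, rfl⟩)
      have h1 : θ (wK f) = ∑ r, wK f r * θ (Pi.single r 1) := by
        conv_lhs => rw [pi_eq_sum_univ' (wK f)]
        simp [map_sum]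
      rw [map_zero, pairing, map_sum, ← smul_zero (b : MvPolynomial σ k), ← h0, h1,
        Finset.smul_sum]
      refine Finset.sum_congr rfl fun r _ => ?_
      rw [map_mul, hG, smul_mul_assoc, mul_comm]
    rw [powAnnihilator_eq_bot hid hφ hι, Submodule.mem_bot] at hGmem
    apply hθ0
    refine LinearMap.pi_ext' fun r => LinearMap.ext_ring ?_
    have := hG r
    rw [hGmem] at this
    rw [Pi.zero_apply, map_zero, Algebra.smul_def] at this
    exact (mul_eq_zero.1 this.symm).resolve_left
      (IsLocalization.to_map_ne_zero_of_mem_nonZeroDivisors K le_rfl b.2)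
  let B := Module.Basis.ofSpan hspan
  have hB : ∀ j, ∃ f, wK f = B j := fun j => Module.Basis.ofSpan_subset hspan ⟨j, rfl⟩
  let e := B.indexEquiv (Pi.basisFun K ι)
  let B' := B.reindex e
  have hB' : ∀ j, ∃ f, wK f = B' j := fun j => by simpa [B'] using hB (e.symm j)
  choose f hf using hB'
  let D : Matrix ι ι (MvPolynomial σ k) := Matrix.of fun j => w (f j)
  -- The rows of `D` form a basis over `K`, and they still do over `k` after any specialization of
  -- `a` at which the determinant survives.
  refine ⟨D.det, ?_, ?_⟩
  · intro h0
    have h1 : LinearIndependent K (D.map (algebraMap _ K)).row := by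
      have : (D.map (algebraMap _ K)).row = B' := funext hf
      rw [this]
      exact B'.linearIndependent
    have h2 := (Matrix.isUnit_iff_isUnit_det _).1 (Matrix.linearIndependent_rows_iff_isUnit.1 h1)
    rw [← RingHom.mapMatrix_apply, ← RingHom.map_det, h0, map_zero] at h2
    exact not_isUnit_zero h2
  · intro a ha y
    have hu : IsUnit (D.map (eval a)) := by
      rw [Matrix.isUnit_iff_isUnit_det, ← RingHom.mapMatrix_apply, ← RingHom.map_det]
      exact ha.isUnit
    obtain ⟨c, hc⟩ := Matrix.vecMul_surjective_iff_isUnit.2 hu y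
    refine ⟨∑ j, c j • eval (fun t => C (a t)) (f j), ?_⟩
    rw [← hc, Finset.mul_sum, map_sum]
    ext r
    rw [Finset.sum_apply]
    refine Finset.sum_congr rfl fun j _ => ?_
    rw [mul_smul_comm, map_smul, Pi.smul_apply, smul_eq_mul]
    congr 1
    simp [D, w, eval_coeffMap, eval_genericForm]

end Generic

/-! ### Graded pieces and the propagation of maximal rank. -/

section Bounds

attribute [local instance] MvPolynomial.gradedAlgebra

variable {k : Type*} [Field k] {n : ℕ} {I : Ideal (MvPolynomial (Fin n) k)}
  {ℓ : MvPolynomial (Fin n) k} {d i j : ℕ}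

theorem mem_gradedPiece {x : MvPolynomial (Fin n) k ⧸ I} :
    x ∈ gradedPiece I j ↔ ∃ f : MvPolynomial (Fin n) k, f.IsHomogeneous j ∧
      Ideal.Quotient.mk I f = x := Iff.rfl

instance gradedPiece_finite : Module.Finite k (gradedPiece I j) :=
  Module.Finite.iff_fg.2 ((homogeneousSubmodule_fg (Fin n) k j).map _)

theorem homogeneousSubmodule_le {N : Submodule k (MvPolynomial (Fin n) k)}
    (h : ∀ ν : Fin n →₀ ℕ, ν.degree = j → ∀ c, monomial ν c ∈ N) :
    homogeneousSubmodule (Fin n) k j ≤ N := by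
  intro f hf
  rw [f.as_sum]
  exact sum_mem fun ν hν => h ν (hf.degree_eq_sum_deg_support hν).symm _

theorem surjectiveInDegree_iff : SurjectiveInDegree I ℓ i j ↔
    ∀ f : MvPolynomial (Fin n) k, f.IsHomogeneous (j + i) →
      ∃ g : MvPolynomial (Fin n) k, g.IsHomogeneous j ∧ f - ℓ ^ i * g ∈ I := by
  constructor
  · intro h f hf
    obtain ⟨_, ⟨g, hg, rfl⟩, hfg⟩ := h (mem_gradedPiece.2 ⟨f, hf, rfl⟩)
    refine ⟨g, hg, ?_⟩
    rw [← Ideal.Quotient.eq, ← hfg]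
    simp [mulPow]
  · rintro h _ ⟨f, hf, rfl⟩
    obtain ⟨g, hg, hfg⟩ := h f hf
    refine ⟨_, ⟨g, hg, rfl⟩, ?_⟩
    rw [← Ideal.Quotient.eq] at hfg
    simp [mulPow, hfg]

theorem surjectiveInDegree_iff_le : SurjectiveInDegree I ℓ i j ↔
    homogeneousSubmodule (Fin n) k (j + i) ≤
      (homogeneousSubmodule (Fin n) k j).map (LinearMap.mulLeft k (ℓ ^ i)) ⊔
        I.restrictScalars k := by
  rw [surjectiveInDegree_iff]
  refine forall₂_congr fun f hf => ?_
  rw [Submodule.mem_sup]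
  constructor
  · rintro ⟨g, hg, h⟩
    exact ⟨_, ⟨g, hg, rfl⟩, _, h, by simp⟩
  · rintro ⟨_, ⟨g, hg, rfl⟩, y, hy, rfl⟩
    exact ⟨g, hg, by simpa using hy⟩

theorem injectiveInDegree_iff : InjectiveInDegree I ℓ i j ↔
    ∀ f : MvPolynomial (Fin n) k, f.IsHomogeneous j → ℓ ^ i * f ∈ I → f ∈ I := by
  constructor
  · intro h f hf hfI
    rw [← Ideal.Quotient.eq_zero_iff_mem]
    refine h ⟨f, hf, rfl⟩ (zero_mem _) ?_
    rw [map_zero]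
    simpa [mulPow] using Ideal.Quotient.eq_zero_iff_mem.2 hfI
  · rintro h _ ⟨f, hf, rfl⟩ _ ⟨g, hg, rfl⟩ hfg
    refine Ideal.Quotient.eq.2 (h _ (hf.sub hg) ?_)
    rw [mul_sub, ← Ideal.Quotient.eq]
    simpa [mulPow] using hfg

/-- Surjectivity propagates to higher degrees. -/
theorem SurjectiveInDegree.succ (h : SurjectiveInDegree I ℓ i j) (hij : 1 ≤ j + i) :
    SurjectiveInDegree I ℓ i (j + 1) := by
  rw [surjectiveInDegree_iff_le]
  refine homogeneousSubmodule_le fun ν hν c => ?_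
  obtain ⟨t, ht⟩ : ∃ t, ν t ≠ 0 := by
    by_contra! h
    have : ν = 0 := by ext t; simpa using h t
    rw [this, map_zero] at hν
    omega
  obtain ⟨ν', rfl⟩ : ∃ ν', ν = Finsupp.single t 1 + ν' :=
    exists_add_of_le (Finsupp.single_le_iff.2 (by omega))
  have hν' : ν'.degree = j + i := by
    rw [map_add, Finsupp.degree_single] at hν
    omega
  obtain ⟨g, hg, hgI⟩ := surjectiveInDegree_iff.1 h _ (isHomogeneous_monomial c hν')
  have h1 : monomial (Finsupp.single t 1 + ν') c = X t * monomial ν' c := by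
    rw [X, monomial_mul, one_mul]
  refine Submodule.mem_sup.2 ⟨_, ⟨X t * g, ?_, rfl⟩, _, I.mul_mem_left (X t) hgI, ?_⟩
  · rw [add_comm]
    exact (isHomogeneous_X k t).mul hg
  · rw [h1, LinearMap.mulLeft_apply]
    ring

theorem SurjectiveInDegree.mono (h : SurjectiveInDegree I ℓ i j) (hij : 1 ≤ j + i) {j' : ℕ}
    (hj : j ≤ j') : SurjectiveInDegree I ℓ i j' := by
  induction j', hj using Nat.le_induction with
  | base => exact h
  | succ m hm ih => exact ih.succ (by omega)

/-- A surjective power factors through each smaller power. -/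
theorem SurjectiveInDegree.of_add {p q : ℕ} (hℓ : ℓ.IsHomogeneous 1)
    (h : SurjectiveInDegree I ℓ (p + q) j) : SurjectiveInDegree I ℓ p (j + q) := by
  rw [surjectiveInDegree_iff] at h ⊢
  intro f hf
  obtain ⟨g, hg, hgI⟩ := h f (by convert hf using 1; omega)
  refine ⟨ℓ ^ q * g, ?_, by rwa [← mul_assoc, ← pow_add]⟩
  have := (hℓ.pow q).mul hg
  rwa [one_mul, add_comm] at this

theorem SurjectiveInDegree.add {p q : ℕ} (hp : SurjectiveInDegree I ℓ p (j + q))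
    (hq : SurjectiveInDegree I ℓ q j) : SurjectiveInDegree I ℓ (p + q) j := by
  rw [surjectiveInDegree_iff] at hp hq ⊢
  intro f hf
  obtain ⟨g, hg, hgI⟩ := hp f (by convert hf using 1; omega)
  obtain ⟨g', hg', hgI'⟩ := hq g hg
  refine ⟨g', hg', ?_⟩
  have : f - ℓ ^ (p + q) * g' = (f - ℓ ^ p * g) + ℓ ^ p * (g - ℓ ^ q * g') := by ring
  rw [this]
  exact I.add_mem hgI (I.mul_mem_left _ hgI')

theorem injectiveInDegree_of_lt (hI : I ≤ idealOfVars (Fin n) k ^ d) (hℓ : ℓ.IsHomogeneous 1)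
    (hℓ0 : ℓ ≠ 0) (hij : j + i < d) : InjectiveInDegree I ℓ i j := by
  rw [injectiveInDegree_iff]
  intro f hf hfI
  have h0 : ℓ ^ i * f = 0 := by
    by_contra hne
    obtain ⟨ν, hν⟩ := support_nonempty.2 hne
    have h1 := (mem_pow_idealOfVars_iff d _).1 (hI hfI) ν hν
    have h2 := (((hℓ.pow i).mul hf).degree_eq_sum_deg_support hν)
    rw [← Finsupp.degree_apply] at h2
    omega
  rw [(mul_eq_zero.1 h0).resolve_left (pow_ne_zero i hℓ0)]
  exact I.zero_mem

/-- Surjectivity onto degree `d` is all that is needed for maximal rank in all degrees. -/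
theorem maximalRankInDegree_of_surjectiveInDegree (hI : I ≤ idealOfVars (Fin n) k ^ d)
    (hℓ : ℓ.IsHomogeneous 1) (hℓ0 : ℓ ≠ 0) (hi : i ≤ d) (hd : 1 ≤ d)
    (h : SurjectiveInDegree I ℓ i (d - i)) (j : ℕ) : MaximalRankInDegree I ℓ i j := by
  by_cases hij : j + i < d
  · exact Or.inl (injectiveInDegree_of_lt hI hℓ hℓ0 hij)
  · exact Or.inr (h.mono (by omega) (by omega))

theorem isHomogeneous_linearForm (a : Fin n → k) :
    (∑ t, C (a t) * X t : MvPolynomial (Fin n) k).IsHomogeneous 1 :=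
  IsHomogeneous.sum _ _ _ fun t _ => isHomogeneous_C_mul_X _ t

theorem coeff_linearForm (a : Fin n → k) (t : Fin n) :
    coeff (Finsupp.single t 1) (∑ s, C (a s) * X s : MvPolynomial (Fin n) k) = a t := by
  classical
  simp [coeff_sum, coeff_C_mul, coeff_X, Finsupp.single_left_inj]

theorem homogeneousComponent_mul_of_le {g : MvPolynomial (Fin n) k} (hℓ : ℓ.IsHomogeneous i)
    (hid : i ≤ d) :
    homogeneousComponent d (ℓ * g) = ℓ * homogeneousComponent (d - i) g := by
  have := DirectSum.coe_decompose_mul_of_left_mem_of_le (homogeneousSubmodule (Fin n) k)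
    (b := g) hℓ hid
  rw [← decomposition.decompose'_apply, ← decomposition.decompose'_apply]
  exact this

/-! ### Lefschetz maps of a general linear form. -/

section CharZero

variable [CharZero k]

/-- If the Hilbert function in degree `d` is at most `d + 1 - i`, then the `i`-th power of a
general linear form maps onto the degree `d` part. -/
theorem exists_surjectiveInDegree (I : Ideal (MvPolynomial (Fin n) k)) (hid : i ≤ d)
    (hHF : HF I d + i ≤ d + 1) :
    ∃ F : MvPolynomial (Fin n) k, F ≠ 0 ∧ ∀ a : Fin n → k, eval a F ≠ 0 →
      SurjectiveInDegree I (∑ t, C (a t) * X t) i (d - i) := by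
  let π : MvPolynomial (Fin n) k →ₗ[k] gradedPiece I d :=
    ((Ideal.Quotient.mkₐ k I).toLinearMap ∘ₗ homogeneousComponent d).codRestrict _
      fun f => ⟨_, homogeneousComponent_mem d f, rfl⟩
  have hπ : ∀ f g, π f = π g → homogeneousComponent d f - homogeneousComponent d g ∈ I :=
    fun f g h => Ideal.Quotient.eq.1 (congrArg Subtype.val h)
  let e := (Module.finBasis k (gradedPiece I d)).equivFun
  obtain ⟨F, hF, h⟩ := exists_forall_eval_ne_zero_surjective (φ := e.toLinearMap ∘ₗ π) hid
    (fun y => by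
      obtain ⟨f, hf, hfy⟩ := (e.symm y).2
      refine ⟨f, hf, ?_⟩
      have : π f = e.symm y := by
        refine Subtype.ext ?_
        rw [← hfy]
        exact congrArg (Ideal.Quotient.mk I) (homogeneousComponent_eq_self hf)
      simp [this])
    (by rwa [Fintype.card_fin])
  refine ⟨F, hF, fun a ha => surjectiveInDegree_iff.2 fun f hf => ?_⟩
  rw [Nat.sub_add_cancel hid] at hf
  obtain ⟨g, hg⟩ := h a ha (e (π f))
  refine ⟨homogeneousComponent (d - i) g, homogeneousComponent_mem _ _, ?_⟩
  have h1 := hπ _ _ (e.injective hg)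
  rw [homogeneousComponent_eq_self hf, homogeneousComponent_mul_of_le (i := i) _ hid] at h1
  · exact Ideal.neg_mem_iff I |>.1 (by rwa [neg_sub])
  · have := (isHomogeneous_linearForm a).pow i
    rwa [one_mul] at this

/-- The `d`-th power of a general linear form avoids an ideal that misses a form of
degree `d`. -/
theorem exists_pow_notMem {f : MvPolynomial (Fin n) k} (hf : f.IsHomogeneous d) (hfI : f ∉ I) :
    ∃ F : MvPolynomial (Fin n) k, F ≠ 0 ∧ ∀ a : Fin n → k, eval a F ≠ 0 →
      (∑ t, C (a t) * X t) ^ d ∉ I := by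
  obtain ⟨θ, hθ⟩ := Module.Projective.exists_dual_ne_zero k
    (x := Ideal.Quotient.mk I f) (by rwa [Ne, Ideal.Quotient.eq_zero_iff_mem])
  let φ : MvPolynomial (Fin n) k →ₗ[k] (Unit → k) :=
    LinearMap.pi fun _ => θ ∘ₗ (Ideal.Quotient.mkₐ k I).toLinearMap
  obtain ⟨F, hF, h⟩ := exists_forall_eval_ne_zero_surjective (φ := φ) (d := d) le_rfl
    (fun y => by
      refine ⟨(y () / θ (Ideal.Quotient.mk I f)) • f, ?_, ?_⟩
      · exact (homogeneousSubmodule (Fin n) k d).smul_mem _ hf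
      · ext
        rw [map_smul]
        exact div_mul_cancel₀ _ hθ)
    (by simp [add_comm])
  refine ⟨F, hF, fun a ha hmem => ?_⟩
  obtain ⟨g, hg⟩ := h a ha 1
  have h1 := congrFun hg ()
  have h2 : Ideal.Quotient.mk I ((∑ t, C (a t) * X t) ^ d * g) = 0 :=
    Ideal.Quotient.eq_zero_iff_mem.2 (I.mul_mem_right _ hmem)
  simp only [φ, LinearMap.pi_apply, LinearMap.comp_apply, AlgHom.toLinearMap_apply,
    Ideal.Quotient.mkₐ_eq_mk, h2, map_zero, Pi.one_apply] at h1
  exact zero_ne_one h1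

theorem forGeneralLinearForm_maximalRankInDegree (hn : 0 < n)
    (hI : I ≤ idealOfVars (Fin n) k ^ d) (hid : i ≤ d) (hd : 1 ≤ d) (hHF : HF I d + i ≤ d + 1) :
    ForGeneralLinearForm fun ℓ => ∀ j, MaximalRankInDegree I ℓ i j := by
  obtain ⟨F, hF, h⟩ := exists_surjectiveInDegree I hid hHF
  -- The extra factor forces a nonzero coefficient, hence `ℓ ≠ 0`.
  refine ⟨F * X ⟨0, hn⟩, mul_ne_zero hF (X_ne_zero _), fun a ha j => ?_⟩
  rw [map_mul, eval_X] at ha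
  refine maximalRankInDegree_of_surjectiveInDegree hI (isHomogeneous_linearForm a) ?_ hid hd
    (h a (left_ne_zero_of_mul ha)) j
  intro h0
  have := coeff_linearForm a ⟨0, hn⟩
  rw [h0, coeff_zero] at this
  exact right_ne_zero_of_mul ha this.symm

end CharZero

/-! ### Artinian quotients and the strong Lefschetz property. -/

/-- A homogeneous ideal with artinian quotient contains all polynomials of large order. -/
theorem exists_pow_idealOfVars_le [IsArtinianRing (MvPolynomial (Fin n) k ⧸ I)]
    (hI : I.IsHomogeneous (homogeneousSubmodule (Fin n) k)) :
    ∃ N, idealOfVars (Fin n) k ^ N ≤ I := by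
  obtain ⟨N, hN⟩ := IsArtinian.monotone_stabilizes
    (⟨fun m => OrderDual.toDual (((idealOfVars (Fin n) k) ^ m).map (Ideal.Quotient.mk I)),
      fun a b hab => OrderDual.toDual_le_toDual.2
        (Ideal.map_mono (Ideal.pow_le_pow_right hab))⟩ :
      ℕ →o (Submodule (MvPolynomial (Fin n) k ⧸ I) (MvPolynomial (Fin n) k ⧸ I))ᵒᵈ)
  refine ⟨N, ?_⟩
  rw [pow_idealOfVars_eq_span, Submodule.span_le]
  rintro _ ⟨ν, hν, rfl⟩
  have hf := isHomogeneous_monomial (1 : k) hν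
  set f : MvPolynomial (Fin n) k := monomial ν 1
  have h1 : ((idealOfVars (Fin n) k) ^ N).map (Ideal.Quotient.mk I) =
    ((idealOfVars (Fin n) k) ^ (N + 1)).map (Ideal.Quotient.mk I) := hN (N + 1) (Nat.le_succ N)
  have h2 : Ideal.Quotient.mk I f ∈ ((idealOfVars (Fin n) k) ^ N).map (Ideal.Quotient.mk I) := by
    refine Ideal.mem_map_of_mem _ ((mem_pow_idealOfVars_iff N f).2 fun ν hν => ?_)
    rw [Finsupp.degree_apply, ← hf.degree_eq_sum_deg_support hν]
  rw [h1, Ideal.mem_map_iff_of_surjective _ Ideal.Quotient.mk_surjective] at h2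
  obtain ⟨g, hg, hgf⟩ := h2
  -- Modulo `I`, `f` agrees with some `g` of order at least `N + 1`, so the degree `N` component of
  -- `g - f` is `-f`.
  have h3 := homogeneousComponent_mem_of_mem hI (Ideal.Quotient.eq.1 hgf) N
  rw [map_sub, homogeneousComponent_eq_self hf] at h3
  have h4 : homogeneousComponent N g = 0 := by
    ext ν
    rw [coeff_homogeneousComponent, coeff_zero]
    split_ifs with h
    · exact (mem_pow_idealOfVars_iff' (N + 1) g).1 hg ν (by omega)
    · rfl
  rw [h4, zero_sub] at h3
  exact (Ideal.neg_mem_iff I).1 h3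

theorem mem_pow_idealOfVars_of_isHomogeneous {f : MvPolynomial (Fin n) k}
    (hf : f.IsHomogeneous j) (hdj : d ≤ j) : f ∈ idealOfVars (Fin n) k ^ d :=
  (mem_pow_idealOfVars_iff d f).2 fun ν hν => by
    rwa [Finsupp.degree_apply, ← hf.degree_eq_sum_deg_support hν]

/-- The ideals of the three classes are homogeneous and start in degree `d`. -/
theorem isHomogeneous_and_le_of_class
    (h : GeneratedInDegree I d ∨ MonomialOfMinDegree I d ∨ HomogeneousOfMinDegree I d) :
    I.IsHomogeneous (homogeneousSubmodule (Fin n) k) ∧ I ≤ idealOfVars (Fin n) k ^ d := by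
  have key : ∀ s : Set (MvPolynomial (Fin n) k), (∀ g ∈ s, ∃ e, d ≤ e ∧ g.IsHomogeneous e) →
      (Ideal.span s).IsHomogeneous (homogeneousSubmodule (Fin n) k) ∧
        Ideal.span s ≤ idealOfVars (Fin n) k ^ d := by
    intro s hs
    refine ⟨Ideal.homogeneous_span _ _ fun g hg => ?_, Ideal.span_le.2 fun g hg => ?_⟩
    · obtain ⟨e, -, he⟩ := hs g hg
      exact ⟨e, he⟩
    · obtain ⟨e, hde, he⟩ := hs g hg
      exact mem_pow_idealOfVars_of_isHomogeneous he hde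
  rcases h with ⟨G, hG, rfl⟩ | ⟨M, hM, -, rfl⟩ | ⟨G, hG, -, rfl⟩
  · exact key _ fun g hg => ⟨d, le_rfl, hG g hg⟩
  · refine key _ ?_
    rintro _ ⟨m, hm, rfl⟩
    exact ⟨_, hM m hm, isHomogeneous_monomial _ rfl⟩
  · exact key _ fun g hg => (hG g hg).2

/-- The case `i = d - 1` of the surjectivity statement gives `R_1 → R_d` onto. Smaller powers
inherit surjectivity onto `R_d` by factoring, larger ones from `R_j` with `j ≥ 1` by composing. Only
`R_0` needs a separate argument. -/
theorem hasSLP_of_HF_le_two [CharZero k] (hn : 0 < n) (hd : 2 ≤ d)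
    [IsArtinianRing (MvPolynomial (Fin n) k ⧸ I)]
    (hI : I.IsHomogeneous (homogeneousSubmodule (Fin n) k))
    (hId : I ≤ idealOfVars (Fin n) k ^ d) (hHF : HF I d ≤ 2) : HasSLP I := by
  classical
  obtain ⟨F, hF, h⟩ := exists_surjectiveInDegree (i := d - 1) I (by omega)
    (by omega : HF I d + (d - 1) ≤ d + 1)
  have hN := exists_pow_idealOfVars_le hI
  -- With `N` least such that all forms of degree `N` lie in `I`, a general `ℓ` has `ℓ ^ (N - 1) ∉
  -- I`. As `R_0` is spanned by `1`, this settles `j = 0`: injective for `p < N`, zero target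
  -- otherwise.
  obtain ⟨F', hF', h'⟩ : ∃ F : MvPolynomial (Fin n) k, F ≠ 0 ∧ ∀ a : Fin n → k, eval a F ≠ 0 →
      ∀ p < Nat.find hN, (∑ t, C (a t) * X t) ^ p ∉ I := by
    rcases Nat.eq_zero_or_pos (Nat.find hN) with h0 | h0
    · exact ⟨1, one_ne_zero, fun a _ p hp => by omega⟩
    · have := Nat.find_min hN (m := Nat.find hN - 1) (by omega)
      rw [pow_idealOfVars_eq_span, Submodule.span_le, Set.not_subset] at this
      obtain ⟨_, ⟨ν, hν, rfl⟩, hνI⟩ := this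
      obtain ⟨F, hF, h⟩ := exists_pow_notMem (isHomogeneous_monomial (1 : k) hν) hνI
      refine ⟨F, hF, fun a ha p hp hmem => h a ha ?_⟩
      rw [show Nat.find hN - 1 = p + (Nat.find hN - 1 - p) by omega, pow_add]
      exact I.mul_mem_right _ hmem
  obtain ⟨a, ha⟩ : ∃ a, eval a (F * F' * X ⟨0, hn⟩) ≠ 0 := by
    by_contra! hall
    exact mul_ne_zero (mul_ne_zero hF hF') (X_ne_zero _) (MvPolynomial.funext fun a => by
      rw [hall a, map_zero])
  rw [map_mul, map_mul, eval_X] at ha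
  have hsurj := h a (left_ne_zero_of_mul (left_ne_zero_of_mul ha))
  have hpow := h' a (right_ne_zero_of_mul (left_ne_zero_of_mul ha))
  have hℓ := isHomogeneous_linearForm a
  have hℓ0 : (∑ t, C (a t) * X t : MvPolynomial (Fin n) k) ≠ 0 := by
    intro h0
    have := coeff_linearForm a ⟨0, hn⟩
    rw [h0, coeff_zero] at this
    exact right_ne_zero_of_mul ha this.symm
  set ℓ : MvPolynomial (Fin n) k := ∑ t, C (a t) * X t
  have hsmall : ∀ p ≤ d - 1, SurjectiveInDegree I ℓ p (d - p) := by
    intro p hp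
    have : SurjectiveInDegree I ℓ (p + (d - 1 - p)) 1 := by
      convert hsurj using 1 <;> omega
    have := this.of_add hℓ
    rwa [show 1 + (d - 1 - p) = d - p by omega] at this
  refine ⟨ℓ, hℓ, fun p hp j => ?_⟩
  by_cases hpd : p ≤ d - 1
  · exact maximalRankInDegree_of_surjectiveInDegree hId hℓ hℓ0 (by omega) (by omega)
      (hsmall p hpd) j
  rcases Nat.eq_zero_or_pos j with rfl | hj
  · by_cases hpN : p < Nat.find hN
    · left
      rw [injectiveInDegree_iff]
      intro f hf hfI
      obtain ⟨c, rfl⟩ : ∃ c, f = C c := ⟨coeff 0 f, by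
        rw [← homogeneousComponent_zero, homogeneousComponent_eq_self hf]⟩
      by_cases hc : c = 0
      · simp [hc]
      · refine absurd ?_ (hpow p hpN)
        have := I.mul_mem_right (C c⁻¹) hfI
        rwa [mul_assoc, ← C_mul, mul_inv_cancel₀ hc, C_1, mul_one] at this
    · right
      rw [surjectiveInDegree_iff]
      intro f hf
      refine ⟨0, isHomogeneous_zero _ _ _, ?_⟩
      rw [mul_zero, sub_zero]
      exact Nat.find_spec hN (mem_pow_idealOfVars_of_isHomogeneous hf (by omega))
  · right
    have : ∀ q, SurjectiveInDegree I ℓ (d - 1 + q) j := by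
      intro q
      induction q with
      | zero => exact hsurj.mono (by omega) (by omega)
      | succ q ih =>
        have := ((hsmall 1 (by omega)).mono (by omega) (by omega)).add ih
        rwa [show 1 + (d - 1 + q) = d - 1 + (q + 1) by omega] at this
    have := this (p - (d - 1))
    rwa [show d - 1 + (p - (d - 1)) = p by omega] at this

/-! ### Monomial ideals and the torus action. -/

/-- Rescaling of the variables. -/
def rescale (b : Fin n → k) : MvPolynomial (Fin n) k →ₐ[k] MvPolynomial (Fin n) k :=
  aeval fun t => C (b t) * X t

theorem rescale_monomial (b : Fin n → k) (ν : Fin n →₀ ℕ) (c : k) :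
    rescale b (monomial ν c) = C (ν.prod fun t e => b t ^ e) * monomial ν c := by
  rw [rescale, aeval_monomial, monomial_eq, algebraMap_eq]
  simp only [Finsupp.prod, mul_pow, Finset.prod_mul_distrib, map_prod, map_pow]
  ring

theorem rescale_isHomogeneous (b : Fin n → k) {f : MvPolynomial (Fin n) k}
    (hf : f.IsHomogeneous j) : (rescale b f).IsHomogeneous j := by
  have := hf.aeval (fun t => C (b t) * X t) fun t => isHomogeneous_C_mul_X (b t) t
  rwa [one_mul] at this

theorem rescale_rescale_inv {b : Fin n → k} (hb : ∀ t, b t ≠ 0) (f : MvPolynomial (Fin n) k) :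
    rescale b⁻¹ (rescale b f) = f := by
  have : (rescale b⁻¹).comp (rescale b) = AlgHom.id k (MvPolynomial (Fin n) k) := by
    ext1 t
    simp only [rescale, AlgHom.comp_apply, aeval_X, map_mul, aeval_C, algebraMap_eq,
      Pi.inv_apply, AlgHom.id_apply]
    rw [← mul_assoc, ← C_mul, mul_inv_cancel₀ (hb t), C_1, one_mul]
  exact DFunLike.congr_fun this f

theorem rescale_mem (h : MonomialOfMinDegree I d) (b : Fin n → k) {f : MvPolynomial (Fin n) k}
    (hf : f ∈ I) : rescale b f ∈ I := by
  obtain ⟨M, -, -, rfl⟩ := h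
  have : Ideal.span ((fun m => monomial m (1 : k)) '' (M : Set (Fin n →₀ ℕ))) ≤
      (Ideal.span ((fun m => monomial m (1 : k)) '' (M : Set (Fin n →₀ ℕ)))).comap
        (rescale b) := by
    refine Ideal.span_le.2 ?_
    rintro _ ⟨m, hm, rfl⟩
    rw [SetLike.mem_coe, Ideal.mem_comap, rescale_monomial]
    exact Ideal.mul_mem_left _ _ (Ideal.subset_span ⟨m, hm, rfl⟩)
  exact this hf

/-- For monomial ideals the sum of the variables is as good as a general linear form. -/
theorem MonomialOfMinDegree.surjectiveInDegree_sum_X (h : MonomialOfMinDegree I d)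
    {a : Fin n → k} (ha : ∀ t, a t ≠ 0)
    (hs : SurjectiveInDegree I (∑ t, C (a t) * X t) i j) :
    SurjectiveInDegree I (∑ t, X t) i j := by
  rw [surjectiveInDegree_iff] at hs ⊢
  intro f hf
  obtain ⟨g, hg, hgI⟩ := hs _ (rescale_isHomogeneous a hf)
  refine ⟨rescale a⁻¹ g, rescale_isHomogeneous _ hg, ?_⟩
  have h1 := rescale_mem h a⁻¹ hgI
  have h2 : (∑ t, C (a t) * X t : MvPolynomial (Fin n) k) = rescale a (∑ t, X t) := by
    simp [rescale]
  rwa [h2, map_sub, map_mul, map_pow, rescale_rescale_inv ha, rescale_rescale_inv ha] at h1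

theorem MonomialOfMinDegree.maximalRankInDegree_sum_X [CharZero k] (hn : 0 < n)
    (h : MonomialOfMinDegree I d) (hid : i ≤ d) (hd : 1 ≤ d) (hHF : HF I d + i ≤ d + 1) (j : ℕ) :
    MaximalRankInDegree I (∑ t, X t) i j := by
  obtain ⟨F, hF, hsurj⟩ := exists_surjectiveInDegree I hid hHF
  -- A general form with all coefficients nonzero is a rescaling of the sum of the variables.
  obtain ⟨a, ha⟩ : ∃ a, eval a (F * ∏ t, X t) ≠ 0 := by
    by_contra! hall
    exact mul_ne_zero hF (Finset.prod_ne_zero_iff.2 fun t _ => X_ne_zero t)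
      (MvPolynomial.funext fun a => by rw [hall a, map_zero])
  rw [map_mul, map_prod] at ha
  simp only [eval_X] at ha
  have ha' := Finset.prod_ne_zero_iff.1 (right_ne_zero_of_mul ha)
  have h1 : (∑ t, X t : MvPolynomial (Fin n) k) = ∑ t, C ((fun _ => 1 : Fin n → k) t) * X t := by
    simp
  refine maximalRankInDegree_of_surjectiveInDegree
    (isHomogeneous_and_le_of_class (Or.inr (Or.inl h))).2 ?_ ?_ hid hd
    (h.surjectiveInDegree_sum_X (fun t => ha' t (Finset.mem_univ t))
      (hsurj a (left_ne_zero_of_mul ha))) j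
  · rw [h1]
    exact isHomogeneous_linearForm _
  · intro h0
    have := coeff_linearForm (fun _ => 1 : Fin n → k) ⟨0, hn⟩
    rw [← h1, h0, coeff_zero] at this
    exact zero_ne_one this

end Bounds

/-! ### The extremal monomial ideals. -/

section Sharpness

variable {k : Type*} [Field k] {n : ℕ} {I : Ideal (MvPolynomial (Fin n) k)}
  {ℓ : MvPolynomial (Fin n) k} {d i j : ℕ}

theorem surjectiveInDegree_of_injectiveInDegree (hℓ : ℓ.IsHomogeneous 1)
    (hHF : HF I (j + i) ≤ HF I j) (h : InjectiveInDegree I ℓ i j) :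
    SurjectiveInDegree I ℓ i j := by
  have hinj : Function.Injective ((mulPow I ℓ i).restrict (mulPow_mapsTo I hℓ i j)) := by
    intro a b hab
    exact Subtype.ext (h a.2 b.2 (congrArg Subtype.val hab))
  have heq := le_antisymm (LinearMap.finrank_le_finrank_of_injective hinj) hHF
  have hsurj := (LinearMap.injective_iff_surjective_of_finrank_eq_finrank heq).1 hinj
  intro y hy
  obtain ⟨a, ha⟩ := hsurj ⟨y, hy⟩
  exact ⟨a, a.2, congrArg Subtype.val ha⟩

/-- Distinct monomials outside a monomial ideal are linearly independent in the quotient. -/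
theorem linearIndependent_mk_monomial {M : Set (Fin n →₀ ℕ)} {ι : Type*}
    {v : ι → Fin n →₀ ℕ} (hv : Function.Injective v) (hM : ∀ i, ∀ m ∈ M, ¬ m ≤ v i) :
    LinearIndependent k fun i => Ideal.Quotient.mk
      (Ideal.span ((fun m => monomial m (1 : k)) '' M)) (monomial (v i) 1) := by
  classical
  rw [linearIndependent_iff']
  intro s g hg i hi
  by_contra hgi
  have h1 : ∑ j ∈ s, monomial (v j) (g j) ∈ Ideal.span ((fun m => monomial m (1 : k)) '' M) := by
    rw [← Ideal.Quotient.eq_zero_iff_mem, map_sum, ← hg]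
    refine Finset.sum_congr rfl fun j _ => ?_
    rw [← Ideal.Quotient.mkₐ_eq_mk k, ← map_smul, smul_monomial, smul_eq_mul, mul_one]
  have h2 : v i ∈ (∑ j ∈ s, monomial (v j) (g j)).support := by
    rw [mem_support_iff, coeff_sum]
    simpa [coeff_monomial, hv.eq_iff, hi] using hgi
  obtain ⟨m, hm, hmv⟩ := mem_ideal_span_monomial_image.1 h1 _ h2
  exact hM i m hm hmv

/-- The exponent of the monomial `x^p y^q z^r`. -/
def triExponent (x y z : Fin n) (p q r : ℕ) : Fin n →₀ ℕ :=
  Finsupp.single x p + Finsupp.single y q + Finsupp.single z r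

theorem degree_triExponent (x y z : Fin n) (p q r : ℕ) :
    (triExponent x y z p q r).degree = p + q + r := by
  simp [triExponent]

theorem monomial_triExponent (x y z : Fin n) (p q r : ℕ) :
    (monomial (triExponent x y z p q r) 1 : MvPolynomial (Fin n) k) =
      X x ^ p * X y ^ q * X z ^ r := by
  simp [triExponent, X_pow_eq_monomial, monomial_mul]

/-- The monomials of degree `e + c` other than `x^s y^(e-s) z^c`. -/
def sharpMonomials (x y z : Fin n) (e c : ℕ) : Finset (Fin n →₀ ℕ) :=
  Finset.univ.finsuppAntidiag (e + c) \
    (Finset.range (e + 1)).image fun s => triExponent x y z s (e - s) c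

variable (k) in
/-- The ideal generated by all monomials of degree `e + c` other than `x^s y^(e-s) z^c`. -/
def sharpIdeal (x y z : Fin n) (e c : ℕ) : Ideal (MvPolynomial (Fin n) k) :=
  Ideal.span ((fun m => monomial m (1 : k)) '' (sharpMonomials x y z e c : Set (Fin n →₀ ℕ)))

variable {x y z : Fin n} {e c : ℕ}

theorem mem_sharpMonomials {m : Fin n →₀ ℕ} : m ∈ sharpMonomials x y z e c ↔
    m.degree = e + c ∧ ∀ s ≤ e, triExponent x y z s (e - s) c ≠ m := by
  simp [sharpMonomials, Finsupp.degree_eq_sum]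

theorem monomial_mem_sharpIdeal {m : Fin n →₀ ℕ} (hm : m ∈ sharpMonomials x y z e c) (a : k) :
    monomial m a ∈ sharpIdeal k x y z e c := by
  have : monomial m a = C a * monomial m (1 : k) := by simp [C_mul_monomial]
  rw [this]
  exact Ideal.mul_mem_left _ _ (Ideal.subset_span ⟨m, hm, rfl⟩)

theorem exists_le_of_mem_sharpIdeal {f : MvPolynomial (Fin n) k}
    (hf : f ∈ sharpIdeal k x y z e c) {ν : Fin n →₀ ℕ} (hν : ν ∈ f.support) :
    ∃ m ∈ sharpMonomials x y z e c, m ≤ ν :=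
  mem_ideal_span_monomial_image.1 hf ν hν

theorem eq_of_le_of_degree_eq {m ν : Fin n →₀ ℕ} (h : m ≤ ν) (hd : m.degree = ν.degree) :
    m = ν := by
  obtain ⟨a, rfl⟩ := exists_add_of_le h
  rw [map_add] at hd
  have : a = 0 := (Finsupp.degree_eq_zero_iff a).1 (by omega)
  rw [this, add_zero]

theorem triExponent_apply_left (hxy : x ≠ y) (hxz : x ≠ z) (p q r : ℕ) :
    triExponent x y z p q r x = p := by
  simp [triExponent, hxy, hxz]

theorem triExponent_apply_right (hxz : x ≠ z) (hyz : y ≠ z) (p q r : ℕ) :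
    triExponent x y z p q r z = r := by
  simp [triExponent, hxz, hyz]

theorem single_mem_sharpMonomials (hxz : x ≠ z) (hyz : y ≠ z) (he : 1 ≤ e) (hc : 1 ≤ c)
    (t : Fin n) : Finsupp.single t (e + c) ∈ sharpMonomials x y z e c := by
  classical
  refine mem_sharpMonomials.2 ⟨by simp, fun s _ h => ?_⟩
  have := DFunLike.congr_fun h z
  rw [triExponent_apply_right hxz hyz, Finsupp.single_apply] at this
  split_ifs at this <;> omega

theorem isArtinianRing_quotient_of_pow_mem {N : ℕ} (h : ∀ t, X t ^ N ∈ I) :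
    IsArtinianRing (MvPolynomial (Fin n) k ⧸ I) := by
  have hint : Algebra.IsIntegral k (MvPolynomial (Fin n) k ⧸ I) := by
    rw [← integralClosure_eq_top_iff, eq_top_iff]
    have htop : (⊤ : Subalgebra k (MvPolynomial (Fin n) k ⧸ I)) =
        (Algebra.adjoin k (Set.range X)).map (Ideal.Quotient.mkₐ k I) := by
      rw [adjoin_range_X, Algebra.map_top,
        (AlgHom.range_eq_top _).2 (Ideal.Quotient.mkₐ_surjective k I)]
    rw [htop, AlgHom.map_adjoin, Algebra.adjoin_le_iff]
    rintro _ ⟨_, ⟨t, rfl⟩, rfl⟩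
    refine ⟨Polynomial.X ^ N, Polynomial.monic_X_pow N, ?_⟩
    rw [Polynomial.eval₂_X_pow, ← map_pow]
    exact Ideal.Quotient.eq_zero_iff_mem.2 (h t)
  have : Module.Finite k (MvPolynomial (Fin n) k ⧸ I) := Algebra.IsIntegral.finite
  exact IsArtinianRing.of_finite k _

theorem HF_sharpIdeal (hxy : x ≠ y) (hxz : x ≠ z) :
    HF (sharpIdeal k x y z e c) (e + c) = e + 1 := by
  have hli : LinearIndependent k fun s : Fin (e + 1) => Ideal.Quotient.mk
      (sharpIdeal k x y z e c) (monomial (triExponent x y z s (e - s) c) 1) := by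
    refine linearIndependent_mk_monomial (fun s s' h => ?_) fun s m hm hle => ?_
    · have := DFunLike.congr_fun h x
      rw [triExponent_apply_left hxy hxz, triExponent_apply_left hxy hxz] at this
      exact Fin.ext this
    · obtain ⟨hdeg, hne⟩ := mem_sharpMonomials.1 hm
      refine hne s (by omega) (eq_of_le_of_degree_eq hle ?_).symm
      rw [hdeg, degree_triExponent]
      omega
  have hspan : gradedPiece (sharpIdeal k x y z e c) (e + c) =
      Submodule.span k (Set.range fun s : Fin (e + 1) => Ideal.Quotient.mk
        (sharpIdeal k x y z e c) (monomial (triExponent x y z s (e - s) c) 1)) := by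
    refine le_antisymm ?_ ?_
    · rw [gradedPiece, Submodule.map_le_iff_le_comap]
      refine homogeneousSubmodule_le fun ν hν a => ?_
      rw [Submodule.mem_comap]
      by_cases hmem : ν ∈ sharpMonomials x y z e c
      · have : (Ideal.Quotient.mkₐ k (sharpIdeal k x y z e c)).toLinearMap (monomial ν a) = 0 :=
          Ideal.Quotient.eq_zero_iff_mem.2 (monomial_mem_sharpIdeal hmem a)
        rw [this]
        exact zero_mem _
      · rw [mem_sharpMonomials] at hmem
        push Not at hmem
        obtain ⟨s, hs, rfl⟩ := hmem hν
        have h1 : monomial (triExponent x y z s (e - s) c) a =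
            a • (monomial (triExponent x y z s (e - s) c) (1 : k)) := by
          rw [smul_monomial, smul_eq_mul, mul_one]
        rw [h1, map_smul]
        exact Submodule.smul_mem _ _ (Submodule.subset_span ⟨⟨s, by omega⟩, rfl⟩)
    · rw [Submodule.span_le]
      rintro _ ⟨s, rfl⟩
      refine ⟨_, isHomogeneous_monomial 1 ?_, rfl⟩
      rw [degree_triExponent]
      omega
  rw [HF, hspan, finrank_span_eq_card hli, Fintype.card_fin]

/-- The ideal is zero in degree `e - 1`, where the `e` monomials in `x, y` and the additional
`x^(e-2) z` are independent; the latter needs `e ≥ 2`. -/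
theorem le_HF_sharpIdeal (hxy : x ≠ y) (hxz : x ≠ z) (hyz : y ≠ z) (he : 2 ≤ e) :
    e + 1 ≤ HF (sharpIdeal k x y z e c) (e - 1) := by
  let v : Option (Fin e) → Fin n →₀ ℕ := fun o =>
    o.elim (triExponent x y z (e - 2) 0 1) fun s => triExponent x y z s (e - 1 - s) 0
  have hdeg : ∀ o, (v o).degree = e - 1 := by
    rintro (_ | s) <;> simp only [v, Option.elim, degree_triExponent] <;> omega
  have hinj : Function.Injective v := by
    intro o o' h
    have hx := DFunLike.congr_fun h x
    have hz := DFunLike.congr_fun h z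
    rcases o with _ | s <;> rcases o' with _ | s' <;>
      simp only [v, Option.elim, triExponent_apply_left hxy hxz,
        triExponent_apply_right hxz hyz] at hx hz
    · rfl
    · omega
    · omega
    · rw [Fin.ext hx]
  have hli : LinearIndependent k fun o => Ideal.Quotient.mk
      (sharpIdeal k x y z e c) (monomial (v o) 1) := by
    refine linearIndependent_mk_monomial hinj fun o m hm hle => ?_
    have h1 := (mem_sharpMonomials.1 hm).1
    have h2 := Finsupp.degree_mono hle
    rw [hdeg] at h2
    omega
  let w : Option (Fin e) → gradedPiece (sharpIdeal k x y z e c) (e - 1) := fun o =>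
    ⟨_, ⟨_, isHomogeneous_monomial 1 (hdeg o), rfl⟩⟩
  have hw : LinearIndependent k w := LinearIndependent.of_comp (Submodule.subtype _) hli
  have := hw.fintype_card_le_finrank
  rwa [Fintype.card_option, Fintype.card_fin] at this

/-- The substitution `x ↦ u`, `y ↦ v`, `z ↦ X`, all other variables to zero. -/
def substitution (x y z : Fin n) (u v : k) : MvPolynomial (Fin n) k →ₐ[k] Polynomial k :=
  aeval fun t => (if t = x then Polynomial.C u else 0) + (if t = y then Polynomial.C v else 0) +
    (if t = z then Polynomial.X else 0)

theorem substitution_monomial_triExponent (hxy : x ≠ y) (hxz : x ≠ z) (hyz : y ≠ z) (u v : k)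
    (p q r : ℕ) : substitution x y z u v (monomial (triExponent x y z p q r) 1) =
      Polynomial.C (u ^ p * v ^ q) * Polynomial.X ^ r := by
  simp [monomial_triExponent, substitution, hxy, hxz, hyz, hxy.symm, hxz.symm, hyz.symm]

theorem substitution_linearForm (u v : k) (a : Fin n → k) :
    substitution x y z u v (∑ t, a t • X t) =
      Polynomial.C (a x * u + a y * v) + Polynomial.C (a z) * Polynomial.X := by
  simp [substitution, smul_add, Finset.sum_add_distrib, Polynomial.smul_eq_C_mul]

/-- Taking the coefficient of `X ^ c` after the substitution thus defines a functional on `R_d`: in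
degree `e + c` only the omitted monomials can contribute to it. -/
theorem coeff_substitution_monomial (hxy : x ≠ y) (hxz : x ≠ z) (hyz : y ≠ z) (u v : k)
    {ν : Fin n →₀ ℕ} (hν : ν ∈ sharpMonomials x y z e c) :
    (substitution x y z u v (monomial ν 1)).coeff c = 0 := by
  classical
  obtain ⟨hdeg, hne⟩ := mem_sharpMonomials.1 hν
  by_cases h : ∃ t, t ≠ x ∧ t ≠ y ∧ t ≠ z ∧ ν t ≠ 0
  · obtain ⟨t, hx, hy, hz, ht⟩ := h
    obtain ⟨ν', rfl⟩ : ∃ ν', ν = Finsupp.single t 1 + ν' :=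
      exists_add_of_le (Finsupp.single_le_iff.2 (by omega))
    have h1 : (monomial (Finsupp.single t 1 + ν') 1 : MvPolynomial (Fin n) k) =
        X t * monomial ν' 1 := by
      rw [X, monomial_mul, one_mul]
    have h2 : substitution x y z u v (X t) = 0 := by
      simp [substitution, hx, hy, hz]
    rw [h1, map_mul, h2, zero_mul, Polynomial.coeff_zero]
  · push Not at h
    have hν' : ν = triExponent x y z (ν x) (ν y) (ν z) := by
      ext t
      simp only [triExponent, Finsupp.add_apply, Finsupp.single_apply]
      by_cases hx : t = x
      · subst hx
        simp [hxy.symm, hxz.symm]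
      by_cases hy : t = y
      · subst hy
        simp [hxy, hyz.symm]
      by_cases hz : t = z
      · subst hz
        simp [hxz, hyz]
      simp [Ne.symm hx, Ne.symm hy, Ne.symm hz, h t hx hy hz]
    rw [hν', substitution_monomial_triExponent hxy hxz hyz, Polynomial.coeff_C_mul_X_pow]
    split_ifs with hcz
    · rw [hν', degree_triExponent] at hdeg
      refine absurd ?_ (hne (ν x) (by omega))
      conv_rhs => rw [hν']
      congr 1
      omega
    · rfl

theorem not_surjectiveInDegree_sharpIdeal (hxy : x ≠ y) (hxz : x ≠ z) (hyz : y ≠ z)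
    (he : 1 ≤ e) (hℓ : ℓ.IsHomogeneous 1) :
    ¬ SurjectiveInDegree (sharpIdeal k x y z e c) ℓ (c + 1) (e - 1) := by
  classical
  intro hs
  rw [surjectiveInDegree_iff, show e - 1 + (c + 1) = e + c by omega] at hs
  obtain ⟨a, rfl⟩ : ∃ a : Fin n → k, ∑ t, a t • X t = ℓ := by
    have : ℓ ∈ homogeneousSubmodule (Fin n) k 1 := hℓ
    rwa [homogeneousSubmodule_one_eq_span_X, Submodule.mem_span_range_iff_exists_fun] at this
  -- At this point `ℓ` specializes to a multiple of `X`, so multiples of `ℓ ^ (c + 1)` have no `X ^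
  -- c` term, while some surviving monomial has a nonzero one.
  obtain ⟨u, v, huv, hne⟩ : ∃ u v : k, a x * u + a y * v = 0 ∧ (u ≠ 0 ∨ v ≠ 0) := by
    by_cases h : a y = 0
    · by_cases h' : a x = 0
      · exact ⟨1, 0, by simp [h'], Or.inl one_ne_zero⟩
      · exact ⟨a y, -a x, by ring, Or.inr (neg_ne_zero.2 h')⟩
    · exact ⟨a y, -a x, by ring, Or.inl h⟩
  obtain ⟨s, hse, hsne⟩ : ∃ s ≤ e, u ^ s * v ^ (e - s) ≠ 0 := by
    rcases hne with h | h
    · exact ⟨e, le_rfl, by simp [h]⟩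
    · exact ⟨0, Nat.zero_le e, by simp [h]⟩
  have hdeg : (triExponent x y z s (e - s) c).degree = e + c := by
    rw [degree_triExponent]
    omega
  obtain ⟨g, hg, hgI⟩ := hs _ (isHomogeneous_monomial 1 hdeg)
  set f := monomial (triExponent x y z s (e - s) c) (1 : k) - (∑ t, a t • X t) ^ (c + 1) * g
  have hf : f.IsHomogeneous (e + c) := by
    refine (isHomogeneous_monomial 1 hdeg).sub ?_
    have := (hℓ.pow (c + 1)).mul hg
    rwa [show 1 * (c + 1) + (e - 1) = e + c by omega] at this
  have h0 : (substitution x y z u v f).coeff c = 0 := by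
    rw [f.as_sum, map_sum, Polynomial.finsetSum_coeff]
    refine Finset.sum_eq_zero fun ν hν => ?_
    obtain ⟨m, hm, hmν⟩ := exists_le_of_mem_sharpIdeal hgI hν
    obtain rfl := eq_of_le_of_degree_eq hmν (by
      rw [(mem_sharpMonomials.1 hm).1, hf.degree_eq_sum_deg_support hν, Finsupp.degree_apply])
    have : monomial m (coeff m f) = coeff m f • monomial m (1 : k) := by
      rw [smul_monomial, smul_eq_mul, mul_one]
    rw [this, map_smul, Polynomial.coeff_smul, coeff_substitution_monomial hxy hxz hyz u v hm,
      smul_zero]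
  have h1 : (substitution x y z u v ((∑ t, a t • X t) ^ (c + 1) * g)).coeff c = 0 := by
    rw [map_mul, map_pow, substitution_linearForm, huv, Polynomial.C_0, zero_add, mul_pow]
    refine Polynomial.X_pow_dvd_iff.1 ?_ c (Nat.lt_succ_self c)
    exact ((Dvd.intro_left _ rfl).mul_right _)
  rw [map_sub, Polynomial.coeff_sub, h1, sub_zero,
    substitution_monomial_triExponent hxy hxz hyz, Polynomial.coeff_C_mul_X_pow, if_pos rfl] at h0
  exact hsne h0

theorem exists_sharp_ideal (k : Type*) [Field k] (hn : 3 ≤ n) (hi : 2 ≤ i) (hid : i ≤ d - 1) :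
    ∃ I : Ideal (MvPolynomial (Fin n) k), IsArtinianRing (MvPolynomial (Fin n) k ⧸ I) ∧
      GeneratedInDegree I d ∧ MonomialOfMinDegree I d ∧ HomogeneousOfMinDegree I d ∧
      HF I d = d - i + 2 ∧
      ∀ ℓ : MvPolynomial (Fin n) k, ℓ.IsHomogeneous 1 →
        ¬ SurjectiveInDegree I ℓ i (d - i) ∧ ¬ MaximalRankInDegree I ℓ i (d - i) := by
  classical
  -- With `i = c + 1` and `d = e + c`, the value `d - i + 2` is `e + 1`; the range of `i` becomes `c
  -- ≥ 1` and `e ≥ 2`.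
  obtain ⟨c, rfl⟩ : ∃ c, i = c + 1 := ⟨i - 1, by omega⟩
  obtain ⟨e, rfl⟩ : ∃ e, d = e + c := ⟨d - c, by omega⟩
  let x : Fin n := ⟨0, by omega⟩
  let y : Fin n := ⟨1, by omega⟩
  let z : Fin n := ⟨2, by omega⟩
  have hxy : x ≠ y := by simp [x, y]
  have hxz : x ≠ z := by simp [x, z]
  have hyz : y ≠ z := by simp [y, z]
  have hpow := single_mem_sharpMonomials (x := x) (y := y) (z := z) (e := e) (c := c) hxz hyz
    (by omega) (by omega)
  have hdeg : ∀ m ∈ sharpMonomials x y z e c, m.degree = e + c := fun m hm =>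
    (mem_sharpMonomials.1 hm).1
  have himage : sharpIdeal k x y z e c = Ideal.span
      (((sharpMonomials x y z e c).image fun m => monomial m (1 : k) : Finset _) : Set _) := by
    rw [Finset.coe_image, sharpIdeal]
  refine ⟨sharpIdeal k x y z e c, isArtinianRing_quotient_of_pow_mem (N := e + c) fun t => ?_,
    ⟨_, ?_, himage⟩, ⟨sharpMonomials x y z e c, fun m hm => (hdeg m hm).ge, ⟨_, hpow x, by simp⟩,
      rfl⟩, ⟨_, ?_, ?_, himage⟩, ?_, fun ℓ hℓ => ?_⟩
  · rw [X_pow_eq_monomial]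
    exact monomial_mem_sharpIdeal (hpow t) 1
  · simp only [Finset.forall_mem_image]
    exact fun m hm => isHomogeneous_monomial 1 (hdeg m hm)
  · simp only [Finset.forall_mem_image]
    exact fun m hm => ⟨by simp, e + c, le_rfl, isHomogeneous_monomial 1 (hdeg m hm)⟩
  · exact ⟨_, Finset.mem_image_of_mem _ (hpow x), isHomogeneous_monomial 1 (hdeg _ (hpow x))⟩
  · rw [HF_sharpIdeal hxy hxz]
    omega
  · rw [show e + c - (c + 1) = e - 1 by omega]
    have hns := not_surjectiveInDegree_sharpIdeal (c := c) hxy hxz hyz (by omega : 1 ≤ e) hℓ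
    -- Since `dim R_{d-i} ≥ dim R_d`, injectivity would imply the excluded surjectivity.
    refine ⟨hns, fun h => h.elim (fun hinj => hns ?_) hns⟩
    refine surjectiveInDegree_of_injectiveInDegree hℓ ?_ hinj
    rw [show e - 1 + (c + 1) = e + c by omega, HF_sharpIdeal hxy hxz]
    exact le_HF_sharpIdeal hxy hxz hyz (by omega)

end Sharpness

end Lefschetz

end

theorem theorem3 {k : Type*} [Field k] [CharZero k] {n d : ℕ} (hn : 3 ≤ n) (hd : 3 ≤ d) :
    -- (i), the bound
    (∀ I : Ideal (MvPolynomial (Fin n) k), IsArtinianRing (MvPolynomial (Fin n) k ⧸ I) →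
      (Lefschetz.GeneratedInDegree I d ∨ Lefschetz.MonomialOfMinDegree I d ∨
        Lefschetz.HomogeneousOfMinDegree I d) →
      ¬ Lefschetz.HasSLP I → 3 ≤ Lefschetz.HF I d) ∧
    -- (i), sharpness, by one example lying in all three classes
    (∃ I : Ideal (MvPolynomial (Fin n) k), IsArtinianRing (MvPolynomial (Fin n) k ⧸ I) ∧
      Lefschetz.GeneratedInDegree I d ∧ Lefschetz.MonomialOfMinDegree I d ∧
      Lefschetz.HomogeneousOfMinDegree I d ∧
      ¬ Lefschetz.HasSLP I ∧ Lefschetz.HF I d = 3 ∧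
      ∀ ℓ : MvPolynomial (Fin n) k, ℓ.IsHomogeneous 1 →
        ¬ Lefschetz.SurjectiveInDegree I ℓ (d - 1) 1) ∧
    -- (ii), the bound, for a general linear form
    (∀ i : ℕ, 1 ≤ i → i ≤ d - 1 →
      ∀ I : Ideal (MvPolynomial (Fin n) k), IsArtinianRing (MvPolynomial (Fin n) k ⧸ I) →
      (Lefschetz.GeneratedInDegree I d ∨ Lefschetz.MonomialOfMinDegree I d ∨
        Lefschetz.HomogeneousOfMinDegree I d) →
      ¬ Lefschetz.ForGeneralLinearForm
        (fun ℓ => ∀ j : ℕ, Lefschetz.MaximalRankInDegree I ℓ i j) →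
      d - i + 2 ≤ Lefschetz.HF I d) ∧
    -- (ii), the bound, for the sum of the variables when the ideal is monomial
    (∀ i : ℕ, 1 ≤ i → i ≤ d - 1 →
      ∀ I : Ideal (MvPolynomial (Fin n) k), IsArtinianRing (MvPolynomial (Fin n) k ⧸ I) →
      Lefschetz.MonomialOfMinDegree I d →
      (∃ j : ℕ, ¬ Lefschetz.MaximalRankInDegree I (∑ t, MvPolynomial.X t) i j) →
      d - i + 2 ≤ Lefschetz.HF I d) ∧
    -- (ii), sharpness, by one example lying in all three classes
    (∀ i : ℕ, 2 ≤ i → i ≤ d - 1 →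
      ∃ I : Ideal (MvPolynomial (Fin n) k), IsArtinianRing (MvPolynomial (Fin n) k ⧸ I) ∧
      Lefschetz.GeneratedInDegree I d ∧ Lefschetz.MonomialOfMinDegree I d ∧
      Lefschetz.HomogeneousOfMinDegree I d ∧
      Lefschetz.HF I d = d - i + 2 ∧
      ∀ ℓ : MvPolynomial (Fin n) k, ℓ.IsHomogeneous 1 →
        ¬ Lefschetz.SurjectiveInDegree I ℓ i (d - i) ∧
        ¬ Lefschetz.MaximalRankInDegree I ℓ i (d - i)) := by
  have hsharp := fun i (hi : 2 ≤ i) (hid : i ≤ d - 1) =>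
    Lefschetz.exists_sharp_ideal (n := n) (d := d) k hn hi hid
  refine ⟨fun I hart hI hSLP => ?_, ?_, fun i hi hid I _ hI hgen => ?_,
    fun i hi hid I _ hI hmax => ?_, hsharp⟩
  · by_contra hHF
    obtain ⟨hhom, hle⟩ := Lefschetz.isHomogeneous_and_le_of_class hI
    exact hSLP (Lefschetz.hasSLP_of_HF_le_two (by omega) (by omega) hhom hle (by omega))
  -- The example for (i) is the case `i = d - 1` of (ii), which requires `d ≥ 3`.
  · obtain ⟨I, hart, hg, hm, hh, hHF, hℓ⟩ := hsharp (d - 1) (by omega) le_rfl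
    rw [show d - (d - 1) = 1 by omega] at hHF hℓ
    refine ⟨I, hart, hg, hm, hh, ?_, hHF, fun ℓ h => (hℓ ℓ h).1⟩
    rintro ⟨ℓ, h, hrank⟩
    exact (hℓ ℓ h).2 (hrank (d - 1) (by omega) 1)
  · by_contra hHF
    exact hgen (Lefschetz.forGeneralLinearForm_maximalRankInDegree (by omega)
      (Lefschetz.isHomogeneous_and_le_of_class hI).2 (by omega) (by omega) (by omega))
  · by_contra hHF
    obtain ⟨j, hj⟩ := hmax
    exact hj (hI.maximalRankInDegree_sum_X (by omega) (by omega) (by omega) (by omega) j)
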